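/- Let $X$ be a countable set, $m\colon X\to(0,\infty)$ (viewed as a measure on $X$), and let $b\colon X\times X\to[0,\infty)$ be symmetric with $b(x,x)=0$, such that the graph with edges $\{x,y\}$, $b(x,y)>0$, is locally finite and connected; $b$ is called a graph over $(X,m)$. Let $\Delta f(x)=\frac1{m(x)}\sum_{y}b(x,y)(f(x)-f(y))$, and denote also by $\Delta$ the closure in $\ell^2(X,m)$ of its restriction to the finitely supported functions $\mathcal C_c(X)$. Assume that $-\Delta$ generates a strongly continuous semigroup $(\mathrm e^{-t\Delta})_{t\ge 0}$ on $\ell^2(X,m)$; this is always the case for the counting measure $m\equiv 1$. Let $$p_t(x,y)=\frac{1}{m(x)m(y)}\langle \delta_x,\mathrm e^{-t\Delta}\delta_y\rangle_{\ell^2(X,m)}$$ be the heat kernel, where $\delta_x$ is the indicator function of $\{x\}$. For $\psi\colon X\to\mathbb R$ let $\Gamma(\psi)(x)=\frac1{2m(x)}\sum_{y}b(x,y)(\psi(x)-\psi(y))^2$, let $$\rho_{\mathcal E}(x,y)=\sup\{|\psi(x)-\psi(y)|\colon \psi\in\mathcal C_c(X)\text{ real-valued},\ \|\Gamma(\psi)\|_\infty\le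 1\},$$ and, for $S>0$, call $b$ $S$-regular if $|\psi(x)-\psi(y)|\le S$ for all such $\psi$ and all $x,y$ with $b(x,y)>0$. Let $\zeta(r)=r\operatorname{arsinh}(r)+1-\sqrt{r^2+1}$ for $r\ge 0$. **Theorem.** Let $S>0$. If $b$ is an $S$-regular graph over $(X,m)$ as above, then $$p_t(x,y)\le\frac{1}{\sqrt{m(x)m(y)}}\exp\left(-\frac{2t}{S^2}\,\zeta\left(\frac{\rho_{\mathcal E}(x,y)S}{2t}\right)\right)$$ for all $x,y\in X$ and $t>0$. Moreover, for every $\varepsilon>0$ there is $\delta=\delta(S,\varepsilon)>0$, depending only on $S$ and $\varepsilon$, such that for every such $S$-regular graph and all $x,y\in X$, $t>0$ with $\rho_{\mathcal E}(x,y)/t<\delta$, $$p_t(x,y)\le\frac{1}{\sqrt{m(x)m(y)}}\exp\left(-\frac{\rho_{\mathcal E}(x,y)^2}{(4+\varepsilon)t}\right).$$ -/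

import Mathlib

open MeasureTheory Filter Topology

universe u

section SemigroupDefs

variable {H : Type*} [NormedAddCommGroup H] [InnerProductSpace ℂ H]

/-- Strongly continuous one-parameter semigroup; only the values `T t` with `0 ≤ t` matter. -/
structure IsC0Semigroup (T : ℝ → H →L[ℂ] H) : Prop where
  zero : T 0 = 1
  add : ∀ s t, 0 ≤ s → 0 ≤ t → T (s + t) = T s ∘L T t
  tendsto_zero : ∀ u, Tendsto (fun t => T t u) (𝓝[>] 0) (𝓝 u)

/-- The graph `{(u, v) : v = lim_{t → 0+} (T t u - u) / t}` of the generator of `T`. -/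
def generatorGraph (T : ℝ → H →L[ℂ] H) : Set (H × H) :=
  {p | Tendsto (fun t : ℝ => (t : ℂ)⁻¹ • (T t p.1 - p.1)) (𝓝[>] 0) (𝓝 p.2)}

end SemigroupDefs

/-- Locally finite connected graphs `b` over `(X,m)`. Summability of `b x` follows from local
finiteness. -/
structure WeightedGraph (X : Type*) where
  m : X → ℝ
  b : X → X → ℝ
  m_pos : ∀ x, 0 < m x
  b_nonneg : ∀ x y, 0 ≤ b x y
  b_symm : ∀ x y, b x y = b y x
  b_self : ∀ x, b x x = 0
  locallyFinite : ∀ x, {y | 0 < b x y}.Finite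
  connected : ∀ x y, Relation.ReflTransGen (fun u v => 0 < b u v) x y

namespace WeightedGraph

section Basic
variable {X : Type*} (G : WeightedGraph X)

/-- The Laplacian `Δ f(x) = 1/m(x) * ∑_y b(x,y) (f(x) - f(y))`; the sum is finite. -/
noncomputable def laplacian (f : X → ℂ) (x : X) : ℂ :=
  (G.m x : ℂ)⁻¹ * ∑' y, (G.b x y : ℂ) * (f x - f y)

/-- `Γ(f,g)(x) = 1/(2 m(x)) * ∑_y b(x,y) (f(x) - f(y)) (g(x) - g(y))`; the sum is finite. -/
noncomputable def energyMeasure (f g : X → ℝ) (x : X) : ℝ :=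
  1 / (2 * G.m x) * ∑' y, G.b x y * ((f x - f y) * (g x - g y))

/-- Real functions `ψ ∈ C_c(X)` with `‖Γ(ψ)‖_∞ ≤ 1`. Here `Γ(ψ) ≥ 0`, and by local finiteness every
finitely supported function lies in the domain of the Dirichlet form. -/
def IsTestFunction (ψ : X → ℝ) : Prop :=
  ψ.support.Finite ∧ ∀ x, G.energyMeasure ψ ψ x ≤ 1

/-- The graph is `S`-regular. -/
def IsRegular (S : ℝ) : Prop :=
  ∀ ψ, G.IsTestFunction ψ → ∀ x y, 0 < G.b x y → |ψ x - ψ y| ≤ S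

/-- Davies' metric `ρ_E(x,y) = sup {|ψ(x) - ψ(y)| : ψ ∈ C_c(X), ‖Γ(ψ)‖_∞ ≤ 1}`. -/
noncomputable def daviesMetric (x y : X) : ℝ :=
  sSup {r | ∃ ψ, G.IsTestFunction ψ ∧ r = |ψ x - ψ y|}

/-- The supremum that defines Davies' metric is finite. -/
theorem bddAbove_daviesMetric (x y : X) :
    BddAbove {r | ∃ ψ, G.IsTestFunction ψ ∧ r = |ψ x - ψ y|} := by
  suffices h : ∃ C, ∀ ψ, G.IsTestFunction ψ → |ψ x - ψ y| ≤ C by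
    obtain ⟨C, hC⟩ := h
    exact ⟨C, by rintro _ ⟨ψ, hψ, rfl⟩; exact hC ψ hψ⟩
  induction G.connected x y with
  | refl => exact ⟨0, fun ψ _ => by simp⟩
  | @tail v w _ hvw ih =>
    obtain ⟨C, hC⟩ := ih
    refine ⟨C + (1 + 2 * G.m v / G.b v w), fun ψ hψ => ?_⟩
    have h1 := hψ.2 v
    have hm := G.m_pos v
    have hsum : Summable fun y => G.b v y * ((ψ v - ψ y) * (ψ v - ψ y)) := by
      refine summable_of_hasFiniteSupport ((G.locallyFinite v).subset fun y hy => ?_)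
      rcases (G.b_nonneg v y).eq_or_lt with h | h
      · exact absurd (by simp [← h]) hy
      · exact h
    have h2 := hsum.le_tsum w fun y _ => mul_nonneg (G.b_nonneg v y) (mul_self_nonneg _)
    rw [energyMeasure, one_div, inv_mul_le_iff₀ (by positivity), mul_one] at h1
    have h3 : (ψ v - ψ w) * (ψ v - ψ w) ≤ 2 * G.m v / G.b v w := by
      rw [le_div_iff₀ hvw]; linarith
    have h4 : |ψ v - ψ w| ≤ 1 + 2 * G.m v / G.b v w := by
      rw [← abs_mul_abs_self] at h3
      nlinarith [sq_nonneg (|ψ v - ψ w| - 1)]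
    exact (abs_sub_le _ (ψ v) _).trans (add_le_add (hC ψ hψ) h4)

variable [MeasurableSpace X]

/-- The measure on `X` with point masses `m(x)`. -/
noncomputable def vertexMeasure : Measure X :=
  Measure.sum fun x => ENNReal.ofReal (G.m x) • Measure.dirac x

/-- The Hilbert space `ℓ²(X,m)`. -/
abbrev L2 : Type _ := Lp ℂ 2 G.vertexMeasure

/-- The graph `{(f, Δ f) : f ∈ C_c(X)}` in `ℓ²(X,m) × ℓ²(X,m)`. All points have positive mass, so
elements of `ℓ²(X,m)` are functions on `X`. -/
def minimalLaplacianGraph : Set (G.L2 × G.L2) :=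
  {p | ∃ f : X → ℂ, f.support.Finite ∧ (∀ x, p.1 x = f x) ∧ ∀ x, p.2 x = G.laplacian f x}

/-- `T` is the heat semigroup `exp(-tΔ)`: the strongly continuous semigroup on `ℓ²(X,m)` whose
generator is `-Δ`, where `Δ` is the closure in `ℓ²(X,m)` of the Laplacian on `C_c(X)`. -/
structure IsHeatSemigroup (T : ℝ → G.L2 →L[ℂ] G.L2) : Prop where
  isC0Semigroup : IsC0Semigroup T
  generator : ∀ u v : G.L2,
    (u, -v) ∈ generatorGraph T ↔ (u, v) ∈ closure G.minimalLaplacianGraph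

variable [DiscreteMeasurableSpace X]

theorem vertexMeasure_singleton (x : X) : G.vertexMeasure {x} = ENNReal.ofReal (G.m x) := by
  rw [vertexMeasure, Measure.sum_apply _ (measurableSet_singleton x), tsum_eq_single x]
  · simp
  · intro y hy
    simp [hy]

/-- The indicator function of `{x}` as an element of `ℓ²(X,m)`. -/
noncomputable def delta (x : X) : G.L2 :=
  indicatorConstLp 2 (measurableSet_singleton x)
    (by rw [G.vertexMeasure_singleton]; exact ENNReal.ofReal_ne_top) (1 : ℂ)

/-- The heat kernel `p_t(x,y) = ⟨δ_x, exp(-tΔ) δ_y⟩ / (m(x) m(y))` (a real number, as `exp(-tΔ)`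
preserves real functions). -/
noncomputable def heatKernel (T : ℝ → G.L2 →L[ℂ] G.L2) (t : ℝ) (x y : X) : ℝ :=
  1 / (G.m x * G.m y) * (inner ℂ (G.delta x) (T t (G.delta y))).re

end Basic

end WeightedGraph

/-- `ζ(x) = x arsinh x + 1 - √(x² + 1)`. -/
noncomputable def zeta (x : ℝ) : ℝ :=
  x * Real.arsinh x + 1 - √(x ^ 2 + 1)

/-! Existence of the heat semigroup. -/

section Semigroup
variable {H : Type*} [NormedAddCommGroup H] [InnerProductSpace ℂ H]

theorem tendsto_of_dense {L : ℝ → H →L[ℂ] H} {L₀ : H →L[ℂ] H} (hL : ∀ t, 0 < t → ‖L t‖ ≤ 1)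
    {D : Set H} (hD : Dense D) (h : ∀ u ∈ D, Tendsto (fun t => L t u) (𝓝[>] 0) (𝓝 (L₀ u)))
    (u : H) : Tendsto (fun t => L t u) (𝓝[>] 0) (𝓝 (L₀ u)) := by
  rw [Metric.tendsto_nhds]
  intro ε hε
  have hC : 0 < 2 + ‖L₀‖ := by positivity
  obtain ⟨w, hwD, hw⟩ := Metric.mem_closure_iff.1 (hD u) (ε / (2 + ‖L₀‖)) (by positivity)
  have h1 := Metric.tendsto_nhds.1 (h w hwD) (ε / (2 + ‖L₀‖)) (by positivity)
  filter_upwards [h1, self_mem_nhdsWithin] with t ht ht0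
  rw [dist_eq_norm] at *
  have e : L t u - L₀ u = L t (u - w) + (L t w - L₀ w) - L₀ (u - w) := by
    simp only [map_sub]; abel
  have a1 : ‖L t (u - w)‖ ≤ ‖u - w‖ :=
    ((L t).le_of_opNorm_le (hL t ht0) _).trans (by rw [one_mul])
  have a2 : ‖L₀ (u - w)‖ ≤ ‖L₀‖ * ‖u - w‖ := L₀.le_opNorm _
  have a3 : ‖L₀‖ * ‖u - w‖ ≤ ‖L₀‖ * (ε / (2 + ‖L₀‖)) := by gcongr
  have a4 : (2 + ‖L₀‖) * (ε / (2 + ‖L₀‖)) = ε := by field_simp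
  rw [e]
  calc _ ≤ ‖L t (u - w)‖ + ‖L t w - L₀ w‖ + ‖L₀ (u - w)‖ :=
        (norm_sub_le _ _).trans (by gcongr; exact norm_add_le _ _)
    _ < ε := by nlinarith

noncomputable def heatFun (t r : ℝ) : ℝ := Real.exp t * expNegInvGlue (r / t)

theorem heatFun_eq {t r : ℝ} (ht : 0 < t) (hr : 0 < r) :
    heatFun t r = Real.exp (-(t * (1 / r - 1))) := by
  have : ¬ r / t ≤ 0 := not_le.2 (div_pos hr ht)
  rw [heatFun, expNegInvGlue, if_neg this, ← Real.exp_add]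
  congr 1
  field_simp
  ring

theorem continuous_heatFun (t : ℝ) : Continuous (heatFun t) := by
  have : Continuous expNegInvGlue := (expNegInvGlue.contDiff (n := 0)).continuous
  unfold heatFun
  fun_prop

theorem heatFun_zero (t : ℝ) : heatFun t 0 = 0 := by
  simp [heatFun]

theorem heatFun_bounds {t r : ℝ} (ht : 0 < t) (h0 : 0 ≤ r) (h1 : r ≤ 1) :
    |heatFun t r| ≤ 1 ∧ |heatFun t r * r - r| ≤ t ∧
      |t⁻¹ * (heatFun t r * (r * r) - r * r) + (r - r * r)| ≤ t := by
  rcases h0.eq_or_lt with rfl | hr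
  · simp [heatFun_zero, ht.le]
  have hs : 0 ≤ 1 / r - 1 := by
    rw [sub_nonneg, le_div_iff₀ hr]; linarith
  rw [heatFun_eq ht hr]
  set s := 1 / r - 1 with hs_def
  have hrs : r * s = 1 - r := by rw [hs_def]; field_simp
  have hts : 0 ≤ t * s := by positivity
  have e0 := Real.exp_pos (-(t * s))
  have e1 : Real.exp (-(t * s)) ≤ 1 := by simpa using hts
  have e2 := Real.add_one_le_exp (-(t * s))
  have e3 : Real.exp (-(t * s)) ≤ 1 - t * s + (t * s) ^ 2 := by
    have h4 : Real.exp (-(t * s)) ≤ 1 / (1 + t * s) := by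
      rw [Real.exp_neg, ← one_div]
      apply one_div_le_one_div_of_le (by positivity)
      linarith [Real.add_one_le_exp (t * s)]
    refine h4.trans ?_
    rw [div_le_iff₀ (by positivity)]
    nlinarith [pow_nonneg hts 3]
  set E := Real.exp (-(t * s))
  refine ⟨by rw [abs_of_pos e0]; exact e1, ?_, ?_⟩
  · rw [abs_le]
    constructor
    · nlinarith [mul_nonneg hr.le (sub_nonneg.2 e2), mul_nonneg ht.le hr.le]
    · nlinarith
  · have k : t⁻¹ * (E * (r * r) - r * r) + (r - r * r) = t⁻¹ * (r * r * (E - 1 + t * s)) := by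
      have : r - r * r = r * (r * s) := by rw [hrs]; ring
      rw [this]; field_simp
    rw [k, abs_of_nonneg (by have : 0 ≤ E - 1 + t * s := by linarith
                             positivity)]
    rw [inv_mul_le_iff₀ ht]
    have : r * r * (E - 1 + t * s) ≤ r * r * (t * s) ^ 2 := by gcongr; linarith
    have k2 : r * r * (t * s) ^ 2 = t * t * (1 - r) ^ 2 := by rw [← hrs]; ring
    have : (1 - r) ^ 2 ≤ 1 := by nlinarith
    nlinarith [mul_pos ht ht]

theorem heatFun_mul {s t : ℝ} (hs : 0 < s) (ht : 0 < t) {r : ℝ} (hr : 0 ≤ r) :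
    heatFun (s + t) r = heatFun s r * heatFun t r := by
  rcases hr.eq_or_lt with rfl | hr
  · simp [heatFun_zero]
  · rw [heatFun_eq hs hr, heatFun_eq ht hr, heatFun_eq (add_pos hs ht) hr, ← Real.exp_add]
    congr 1; ring

variable [CompleteSpace H]

/-- Existence part for an operator `R` playing the role of `(1 + A)⁻¹`. -/
theorem exists_semigroup_of_resolvent (R : H →L[ℂ] H) (h0 : 0 ≤ R) (h1 : ‖R‖ ≤ 1)
    (hd : DenseRange R) :
    ∃ T : ℝ → H →L[ℂ] H, IsC0Semigroup T ∧
      ∀ u v, (u, -v) ∈ generatorGraph T ↔ u = R (u + v) := by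
  have hsa : IsSelfAdjoint R := IsSelfAdjoint.of_nonneg h0
  have hspec : ∀ r ∈ spectrum ℝ R, 0 ≤ r ∧ r ≤ 1 := fun r hr =>
    ⟨spectrum_nonneg_of_nonneg h0 hr, by
      have hn : Nontrivial (H →L[ℂ] H) := by
        by_contra hh
        rw [not_nontrivial_iff_subsingleton] at hh
        simp [spectrum.of_subsingleton] at hr
      exact (le_abs_self r).trans ((spectrum.norm_le_norm_of_mem hr).trans h1)⟩
  have hc : ∀ t, ContinuousOn (heatFun t) (spectrum ℝ R) := fun t =>
    (continuous_heatFun t).continuousOn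
  set C : ℝ → H →L[ℂ] H := fun t => cfc (heatFun t) R with hC
  have hCn : ∀ t, 0 < t → ‖C t‖ ≤ 1 := fun t ht =>
    norm_cfc_le zero_le_one fun r hr => (heatFun_bounds ht (hspec r hr).1 (hspec r hr).2).1
  have hRid : cfc (fun r : ℝ => r) R = R := cfc_id' ℝ R
  have hCR : ∀ t, C t * R = cfc (fun r => heatFun t r * r) R := fun t => by
    rw [cfc_mul _ _ R (hc t) (continuousOn_id' _), hRid]
  have hRR : R * R = cfc (fun r : ℝ => r * r) R := by
    rw [cfc_mul (fun r : ℝ => r) (fun r : ℝ => r) R (continuousOn_id' _) (continuousOn_id' _), hRid]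
  have hCRR : ∀ t, C t * (R * R) = cfc (fun r => heatFun t r * (r * r)) R := fun t => by
    rw [cfc_mul _ _ R (hc t) (by fun_prop), ← hRR]
  have est1 : ∀ t, 0 < t → ‖C t * R - R‖ ≤ t := fun t ht => by
    have := hc t
    have e : C t * R - R = cfc (fun r => heatFun t r * r - r) R := by
      rw [cfc_sub (fun r => heatFun t r * r) (fun r => r) R (by fun_prop) (by fun_prop),
        ← hCR, hRid]
    rw [e]
    exact norm_cfc_le ht.le fun r hr => (heatFun_bounds ht (hspec r hr).1 (hspec r hr).2).2.1
  have est2 : ∀ t, 0 < t → ‖t⁻¹ • (C t * (R * R) - R * R) + (R - R * R)‖ ≤ t := fun t ht => by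
    have := hc t
    have e : t⁻¹ • (C t * (R * R) - R * R) + (R - R * R) =
        cfc (fun r => t⁻¹ * (heatFun t r * (r * r) - r * r) + (r - r * r)) R := by
      rw [cfc_add (a := R) (fun r => t⁻¹ * (heatFun t r * (r * r) - r * r)) (fun r => r - r * r)
        (by fun_prop) (by fun_prop), cfc_const_mul (a := R) t⁻¹ _ (by fun_prop),
        cfc_sub (fun r => heatFun t r * (r * r)) (fun r => r * r) R (by fun_prop) (by fun_prop),
        cfc_sub (fun r => r) (fun r => r * r) R (by fun_prop) (by fun_prop), ← hCRR, ← hRR, hRid]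
    rw [e]
    exact norm_cfc_le ht.le fun r hr => (heatFun_bounds ht (hspec r hr).1 (hspec r hr).2).2.2
  have tid : Tendsto (fun t : ℝ => t) (𝓝[>] 0) (𝓝 0) := tendsto_nhdsWithin_of_tendsto_nhds tendsto_id
  let T : ℝ → H →L[ℂ] H := fun t => if t ≤ 0 then 1 else C t
  have hT : ∀ t, 0 < t → T t = C t := fun t ht => if_neg (not_le.2 ht)
  have gen : ∀ f, Tendsto (fun t : ℝ => (t : ℂ)⁻¹ • (T t (R f) - R f)) (𝓝[>] 0)
      (𝓝 (-(f - R f))) := by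
    intro f
    let L : ℝ → H →L[ℂ] H := fun t => (t : ℂ)⁻¹ • (C t * R - R)
    have hL : ∀ t, 0 < t → ‖L t‖ ≤ 1 := fun t ht => by
      rw [norm_smul, norm_inv, Complex.norm_real, Real.norm_of_nonneg ht.le,
        inv_mul_le_iff₀ ht, mul_one]
      exact est1 t ht
    have key : ∀ f, Tendsto (fun t => L t f) (𝓝[>] 0) (𝓝 ((R - 1 : H →L[ℂ] H) f)) := by
      refine tendsto_of_dense hL hd ?_
      rintro _ ⟨h, rfl⟩
      rw [tendsto_iff_norm_sub_tendsto_zero]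
      refine squeeze_zero' (Eventually.of_forall fun _ => norm_nonneg _) ?_
        (by simpa using tid.mul_const ‖h‖ : Tendsto (fun t : ℝ => t * ‖h‖) (𝓝[>] 0) (𝓝 0))
      filter_upwards [self_mem_nhdsWithin] with t ht
      refine le_trans (le_of_eq ?_) (ContinuousLinearMap.le_of_opNorm_le _ (est2 t ht) h)
      congr 1
      simp [L]
      rw [← Complex.coe_smul]
      push_cast
      abel
    refine ((key f).congr' ?_).trans (by simp)
    filter_upwards [self_mem_nhdsWithin] with t ht
    simp [L, hT t ht]
  refine ⟨T, ⟨if_pos le_rfl, ?_, ?_⟩, ?_⟩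
  · intro s t hs ht
    rcases hs.eq_or_lt with rfl | hs
    · simp [T]; rfl
    rcases ht.eq_or_lt with rfl | ht
    · simp [T]; rfl
    rw [hT _ hs, hT _ ht, hT _ (add_pos hs ht)]
    change _ = C s * C t
    rw [← cfc_mul _ _ R (hc s) (hc t)]
    exact cfc_congr fun r hr => heatFun_mul hs ht (hspec r hr).1
  · intro u
    have := tendsto_of_dense (L₀ := 1) hCn hd (by
      rintro _ ⟨h, rfl⟩
      rw [tendsto_iff_norm_sub_tendsto_zero]
      refine squeeze_zero' (Eventually.of_forall fun _ => norm_nonneg _) ?_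
        (by simpa using tid.mul_const ‖h‖ : Tendsto (fun t : ℝ => t * ‖h‖) (𝓝[>] 0) (𝓝 0))
      filter_upwards [self_mem_nhdsWithin] with t ht
      exact ContinuousLinearMap.le_of_opNorm_le _ (est1 t ht) h) u
    refine this.congr' ?_
    filter_upwards [self_mem_nhdsWithin] with t ht
    rw [hT t ht]
  · intro u v
    constructor
    · intro h
      have h2 := gen (u + v)
      set w := u - R (u + v) with hw
      have h3 : Tendsto (fun t : ℝ => (t : ℂ)⁻¹ • (T t w - w)) (𝓝[>] 0) (𝓝 w) := by
        have := Tendsto.sub h h2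
        refine (this.congr fun t => ?_).trans (by
          rw [hw]; apply le_of_eq; congr 1; dsimp only; abel)
        rw [← smul_sub, hw, map_sub]; congr 1; abel
      have h4 : Tendsto (fun t : ℝ => (inner ℂ w ((t : ℂ)⁻¹ • (T t w - w))).re) (𝓝[>] 0)
          (𝓝 (inner ℂ w w).re) :=
        (Complex.continuous_re.tendsto _).comp (tendsto_const_nhds.inner h3)
      have h5 : (inner ℂ w w).re ≤ 0 := by
        refine le_of_tendsto h4 ?_
        filter_upwards [self_mem_nhdsWithin] with t ht
        rw [inner_smul_right, ← Complex.ofReal_inv, Complex.re_ofReal_mul, inner_sub_right,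
          Complex.sub_re]
        have a : (inner ℂ w (T t w)).re ≤ ‖w‖ * ‖w‖ := by
          refine (Complex.re_le_norm _).trans ((norm_inner_le_norm _ _).trans ?_)
          gcongr
          rw [hT t ht]
          simpa using (C t).le_of_opNorm_le (hCn t ht) w
        have b : (inner ℂ w w).re = ‖w‖ * ‖w‖ := by
          have := inner_self_eq_norm_mul_norm (𝕜 := ℂ) w
          simpa using this
        have : 0 ≤ t⁻¹ := inv_nonneg.2 (le_of_lt ht)
        nlinarith
      have h6 : w = 0 := by
        have := inner_self_eq_norm_mul_norm (𝕜 := ℂ) w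
        have h7 : (inner ℂ w w).re = ‖w‖ * ‖w‖ := by simpa using this
        have : ‖w‖ = 0 := by nlinarith [norm_nonneg w]
        simpa using this
      exact sub_eq_zero.1 h6
    · intro h
      have := gen (u + v)
      rw [← h, add_sub_cancel_left] at this
      exact this

/-- A densely defined symmetric nonnegative operator `M` (given by its graph) such that `1 + M` has
dense range is essentially self-adjoint, and minus its closure generates a semigroup. -/
theorem exists_semigroup_of_graph (M : Submodule ℂ (H × H))
    (hsymm : ∀ p ∈ M, ∀ q ∈ M, inner ℂ p.2 q.1 = inner ℂ p.1 q.2)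
    (hpos : ∀ p ∈ M, 0 ≤ (inner ℂ p.1 p.2).re)
    (hdom : Dense (Prod.fst '' (M : Set (H × H))))
    (hran : Dense ((fun p : H × H => p.1 + p.2) '' (M : Set (H × H)))) :
    ∃ T : ℝ → H →L[ℂ] H, IsC0Semigroup T ∧
      ∀ u v, (u, -v) ∈ generatorGraph T ↔ (u, v) ∈ closure (M : Set (H × H)) := by
  set A := M.topologicalClosure with hA
  have hAc : (A : Set (H × H)) = closure M := M.topologicalClosure_coe
  have hAclosed : IsClosed (A : Set (H × H)) := M.isClosed_topologicalClosure
  have sub : (M : Set (H × H)) ⊆ A := M.le_topologicalClosure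
  have symm1 : ∀ p ∈ M, ∀ q ∈ A, inner ℂ p.2 q.1 = inner ℂ p.1 q.2 := fun p hp q hq => by
    have : (A : Set (H × H)) ⊆ {q | inner ℂ p.2 q.1 = inner ℂ p.1 q.2} := by
      rw [hAc]
      exact closure_minimal (fun q hq => hsymm p hp q hq)
        (isClosed_eq (by fun_prop) (by fun_prop))
    exact this hq
  have symm : ∀ p ∈ A, ∀ q ∈ A, inner ℂ p.2 q.1 = inner ℂ p.1 q.2 := fun p hp q hq => by
    have : (A : Set (H × H)) ⊆ {p | inner ℂ p.2 q.1 = inner ℂ p.1 q.2} := by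
      rw [hAc]
      exact closure_minimal (fun p hp => symm1 p hp q hq)
        (isClosed_eq (by fun_prop) (by fun_prop))
    exact this hp
  have pos : ∀ p ∈ A, 0 ≤ (inner ℂ p.1 p.2).re := fun p hp => by
    have : (A : Set (H × H)) ⊆ {p | 0 ≤ (inner ℂ p.1 p.2).re} := by
      rw [hAc]
      exact closure_minimal (fun p hp => hpos p hp)
        (isClosed_le continuous_const (Complex.continuous_re.comp (by fun_prop)))
    exact this hp
  have ineq : ∀ p ∈ A, ‖p.1‖ ≤ ‖p.1 + p.2‖ ∧ ‖p.2‖ ≤ ‖p.1 + p.2‖ := fun p hp => by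
    have := pos p hp
    have h := @norm_add_sq ℂ _ _ _ _ p.1 p.2
    simp only [RCLike.re_to_complex] at h
    constructor <;> refine abs_le_of_sq_le_sq' ?_ (norm_nonneg _) |>.2 <;>
      nlinarith [sq_nonneg ‖p.1‖, sq_nonneg ‖p.2‖]
  have surj : ∀ f, ∃ p ∈ A, p.1 + p.2 = f := by
    let Φ : A →L[ℂ] H := (ContinuousLinearMap.fst ℂ H H + ContinuousLinearMap.snd ℂ H H) ∘L A.subtypeL
    have hΦ : ∀ p : A, Φ p = p.1.1 + p.1.2 := fun p => rfl
    have anti : AntilipschitzWith 1 Φ := by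
      refine Φ.antilipschitz_of_bound fun p => ?_
      have := ineq p.1 p.2
      rw [hΦ, NNReal.coe_one, one_mul]
      exact max_le this.1 this.2
    have : CompleteSpace A := hAclosed.completeSpace_coe
    have cl : IsClosed (Set.range Φ) := anti.isClosed_range Φ.uniformContinuous
    have de : Dense (Set.range Φ) := hran.mono (by
      rintro _ ⟨p, hp, rfl⟩
      exact ⟨⟨p, sub hp⟩, rfl⟩)
    intro f
    obtain ⟨p, hp⟩ : f ∈ Set.range Φ := by
      rw [← cl.closure_eq]; exact de f
    exact ⟨p.1, p.2, hp⟩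
  have uniq : ∀ p ∈ A, ∀ q ∈ A, p.1 + p.2 = q.1 + q.2 → p.1 = q.1 := fun p hp q hq h => by
    have := (ineq (p - q) (A.sub_mem hp hq)).1
    have e : (p - q).1 + (p - q).2 = 0 := by
      rw [Prod.fst_sub, Prod.snd_sub, sub_add_sub_comm, h, sub_self]
    rw [e, norm_zero] at this
    exact sub_eq_zero.1 (norm_le_zero_iff.1 this)
  choose P hPA hP using surj
  let R : H →L[ℂ] H := LinearMap.mkContinuous
    { toFun := fun f => (P f).1
      map_add' := fun f g => uniq _ (hPA _) (P f + P g) (A.add_mem (hPA _) (hPA _)) (by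
        rw [hP, Prod.fst_add, Prod.snd_add, add_add_add_comm, hP, hP])
      map_smul' := fun c f => uniq _ (hPA _) (c • P f) (A.smul_mem _ (hPA _)) (by
        rw [hP, Prod.smul_fst, Prod.smul_snd, ← smul_add, hP]) } 1 (fun f => by
        have := (ineq _ (hPA f)).1
        rw [hP] at this
        simpa using this)
  have hRP : ∀ f, R f = (P f).1 := fun f => rfl
  have hRn : ‖R‖ ≤ 1 := LinearMap.mkContinuous_norm_le _ zero_le_one _
  have hR0 : 0 ≤ R := by
    rw [ContinuousLinearMap.nonneg_iff_isPositive]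
    refine ContinuousLinearMap.isPositive_def.2 ⟨fun f g => ?_, fun f => ?_⟩
    · change inner ℂ (R f) g = inner ℂ f (R g)
      rw [hRP, hRP]
      nth_rewrite 1 [← hP g]
      nth_rewrite 2 [← hP f]
      rw [inner_add_right, inner_add_left, symm _ (hPA f) _ (hPA g)]
    · rw [ContinuousLinearMap.reApplyInnerSelf_apply, hRP]
      nth_rewrite 2 [← hP f]
      rw [inner_add_right, map_add]
      exact add_nonneg inner_self_nonneg (pos _ (hPA f))
  have hmem : ∀ u v, u = R (u + v) ↔ (u, v) ∈ A := by
    intro u v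
    constructor
    · intro h
      have h1 := hP (u + v)
      rw [hRP] at h
      have : P (u + v) = (u, v) := by
        refine Prod.ext h.symm ?_
        rw [← h] at h1
        exact add_left_cancel h1
      rw [← this]; exact hPA _
    · intro h
      exact uniq (u, v) h _ (hPA _) (hP _).symm
  have hRd : DenseRange R := by
    refine hdom.mono ?_
    rintro _ ⟨p, hp, rfl⟩
    exact ⟨p.1 + p.2, ((hmem p.1 p.2).2 (sub hp)).symm⟩
  obtain ⟨T, hT, hg⟩ := exists_semigroup_of_resolvent R hR0 hRn hRd
  refine ⟨T, hT, fun u v => ?_⟩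
  rw [hg, hmem, ← hAc]
  rfl
end Semigroup

namespace WeightedGraph

section Existence
variable {X : Type*} (G : WeightedGraph X)

/-- A finite set containing `A` and all neighbours of `A`. -/
theorem exists_nbhd {A : Set X} (hA : A.Finite) :
    ∃ s : Finset X, A ⊆ s ∧ ∀ x ∈ A, ∀ y, 0 < G.b x y → y ∈ s := by
  have h : (A ∪ ⋃ x ∈ A, {y | 0 < G.b x y}).Finite :=
    hA.union (hA.biUnion fun x _ => G.locallyFinite x)
  refine ⟨h.toFinset, fun x hx => ?_, fun x hx y hy => ?_⟩
  · simp [hx]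
  · simp only [Set.Finite.mem_toFinset, Set.mem_union, Set.mem_iUnion]
    exact Or.inr ⟨x, hx, hy⟩

theorem laplacian_eq_sum {f : X → ℂ} {s : Finset X} (h1 : f.support ⊆ s)
    (h2 : ∀ x ∈ f.support, ∀ y, 0 < G.b x y → y ∈ s) (x : X) :
    G.laplacian f x = (G.m x : ℂ)⁻¹ * ∑ y ∈ s, (G.b x y : ℂ) * (f x - f y) := by
  rw [laplacian, tsum_eq_sum]
  intro y hy
  have hfy : f y = 0 := by
    by_contra h; exact hy (h1 h)
  by_cases hx : f x = 0
  · simp [hx, hfy]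
  · rcases (G.b_nonneg x y).eq_or_lt with h | h
    · simp [← h]
    · exact absurd (h2 x hx y h) hy

theorem laplacian_eq_zero {f : X → ℂ} {s : Finset X} (h1 : f.support ⊆ s)
    (h2 : ∀ x ∈ f.support, ∀ y, 0 < G.b x y → y ∈ s) {x : X} (hx : x ∉ s) :
    G.laplacian f x = 0 := by
  have hfx : f x = 0 := by
    by_contra h; exact hx (h1 h)
  rw [G.laplacian_eq_sum h1 h2, Finset.sum_eq_zero, mul_zero]
  intro y _
  by_cases hy : f y = 0
  · simp [hfx, hy]
  · rcases (G.b_nonneg x y).eq_or_lt with h | h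
    · simp [← h]
    · exact absurd (h2 y hy x (by rwa [G.b_symm])) hx

theorem sum_green (s : Finset X) (a c : X → ℂ) :
    ∑ x ∈ s, ∑ y ∈ s, (G.b x y : ℂ) * (a x * (c x - c y)) =
      1 / 2 * ∑ x ∈ s, ∑ y ∈ s, (G.b x y : ℂ) * ((a x - a y) * (c x - c y)) := by
  have h : ∑ x ∈ s, ∑ y ∈ s, (G.b x y : ℂ) * (a x * (c x - c y)) =
      ∑ x ∈ s, ∑ y ∈ s, (G.b x y : ℂ) * (a y * (c y - c x)) := by
    rw [Finset.sum_comm]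
    refine Finset.sum_congr rfl fun x _ => Finset.sum_congr rfl fun y _ => ?_
    rw [G.b_symm]
  have h2 : ∑ x ∈ s, ∑ y ∈ s, (G.b x y : ℂ) * ((a x - a y) * (c x - c y)) =
      ∑ x ∈ s, ∑ y ∈ s, (G.b x y : ℂ) * (a x * (c x - c y)) +
      ∑ x ∈ s, ∑ y ∈ s, (G.b x y : ℂ) * (a y * (c y - c x)) := by
    simp only [← Finset.sum_add_distrib]
    refine Finset.sum_congr rfl fun x _ => Finset.sum_congr rfl fun y _ => ?_
    ring
  rw [h2, ← h]; ring

theorem laplacian_support_finite {f : X → ℂ} (hf : f.support.Finite) :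
    (G.laplacian f).support.Finite := by
  obtain ⟨s, h1, h2⟩ := G.exists_nbhd hf
  refine s.finite_toSet.subset fun x hx => ?_
  by_contra h
  exact hx (G.laplacian_eq_zero h1 h2 h)

theorem summable_laplacian (f : X → ℂ) (x : X) :
    Summable fun y => (G.b x y : ℂ) * (f x - f y) := by
  refine summable_of_hasFiniteSupport ((G.locallyFinite x).subset fun y hy => ?_)
  rcases (G.b_nonneg x y).eq_or_lt with h | h
  · exact absurd (by simp [← h]) hy
  · exact h

theorem laplacian_add (f g : X → ℂ) (x : X) :
    G.laplacian (f + g) x = G.laplacian f x + G.laplacian g x := by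
  rw [laplacian, laplacian, laplacian, ← mul_add,
    ← (G.summable_laplacian f x).tsum_add (G.summable_laplacian g x)]
  congr 2; ext y; simp only [Pi.add_apply]; ring

theorem laplacian_smul (c : ℂ) (f : X → ℂ) (x : X) :
    G.laplacian (c • f) x = c * G.laplacian f x := by
  simp only [laplacian, Pi.smul_apply, smul_eq_mul, ← mul_sub, mul_left_comm _ c, tsum_mul_left]

variable [MeasurableSpace X]

theorem ext_L2 {u v : G.L2} (h : ∀ x, u x = v x) : u = v := Lp.ext (ae_of_all _ h)

variable [DiscreteMeasurableSpace X]

theorem ae_vertexMeasure {P : X → Prop} (h : ∀ᵐ x ∂G.vertexMeasure, P x) (x : X) : P x := by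
  by_contra hx
  have : G.vertexMeasure {x} ≤ 0 := (measure_mono (by simpa using hx)).trans (ae_iff.1 h).le
  rw [G.vertexMeasure_singleton] at this
  exact absurd (ENNReal.ofReal_eq_zero.1 (nonpos_iff_eq_zero.1 this)) (not_le.2 (G.m_pos x))

theorem exists_L2 {f : X → ℂ} (hf : f.support.Finite) : ∃ u : G.L2, ∀ x, u x = f x := by
  have h1 : MemLp (fun z => ∑ x ∈ hf.toFinset, Set.indicator {x} (fun _ => f x) z) 2
      G.vertexMeasure :=
    memLp_finsetSum _ fun x _ => memLp_indicator_const 2 (measurableSet_singleton x) _ (Or.inr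
      (by rw [G.vertexMeasure_singleton]; exact ENNReal.ofReal_ne_top))
  refine ⟨h1.toLp, fun x => ?_⟩
  rw [G.ae_vertexMeasure h1.coeFn_toLp x]
  by_cases hx : f x = 0
  · rw [hx]
    refine Finset.sum_eq_zero fun y hy => ?_
    by_cases hxy : x = y
    · subst hxy; simp [hx]
    · simp [hxy]
  · beta_reduce
    rw [Finset.sum_eq_single x]
    · simp
    · intro y _ hy; simp [Ne.symm hy]
    · intro h; simp [hx] at h

theorem inner_eq_sum (u v : G.L2) (s : Finset X) (hs : ∀ x, x ∉ s → v x = 0) :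
    inner ℂ u v = ∑ x ∈ s, (G.m x : ℂ) * (star (u x) * v x) := by
  rw [L2.inner_def, ← setIntegral_eq_integral_of_forall_compl_eq_zero (s := (s : Set X)),
    setIntegral_finset]
  · refine Finset.sum_congr rfl fun x _ => ?_
    rw [Measure.real, G.vertexMeasure_singleton, ENNReal.toReal_ofReal (G.m_pos x).le,
      RCLike.inner_apply, Complex.real_smul, mul_comm (v x)]
    rfl
  · exact (L2.integrable_inner (𝕜 := ℂ) u v).integrableOn
  · intro x hx
    rw [hs x hx, inner_zero_right]

/-- `⟨u, Δ g⟩` for finitely supported `g`. -/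
theorem inner_laplacian (u v : G.L2) {g : X → ℂ} {s : Finset X} (h1 : g.support ⊆ s)
    (h2 : ∀ x ∈ g.support, ∀ y, 0 < G.b x y → y ∈ s) (hv : ∀ x, v x = G.laplacian g x) :
    inner ℂ u v =
      1 / 2 * ∑ x ∈ s, ∑ y ∈ s, (G.b x y : ℂ) * ((star (u x) - star (u y)) * (g x - g y)) := by
  rw [G.inner_eq_sum u v s fun x hx => by rw [hv, G.laplacian_eq_zero h1 h2 hx],
    ← G.sum_green s (fun x => star (u x)) g]
  refine Finset.sum_congr rfl fun x _ => ?_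
  have : (G.m x : ℂ) ≠ 0 := by exact_mod_cast (G.m_pos x).ne'
  rw [hv, G.laplacian_eq_sum h1 h2, Finset.mul_sum, Finset.mul_sum, Finset.mul_sum]
  refine Finset.sum_congr rfl fun y _ => ?_
  field_simp

/-- The graph of `Δ` on finitely supported functions is a linear subspace. -/
def minimalLaplacianSubmodule : Submodule ℂ (G.L2 × G.L2) where
  carrier := G.minimalLaplacianGraph
  zero_mem' := ⟨0, by simp, fun x => G.ae_vertexMeasure (Lp.coeFn_zero ℂ 2 _) x, fun x => by
    have := G.ae_vertexMeasure (Lp.coeFn_zero ℂ 2 G.vertexMeasure) x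
    simpa [laplacian] using this⟩
  add_mem' := by
    rintro p q ⟨f, hf, hf1, hf2⟩ ⟨g, hg, hg1, hg2⟩
    refine ⟨f + g, (hf.union hg).subset (Function.support_add f g), fun x => ?_, fun x => ?_⟩
    · rw [Prod.fst_add, G.ae_vertexMeasure (Lp.coeFn_add p.1 q.1) x, Pi.add_apply, hf1, hg1]
      rfl
    · rw [Prod.snd_add, G.ae_vertexMeasure (Lp.coeFn_add p.2 q.2) x, Pi.add_apply, hf2, hg2,
        laplacian_add]
  smul_mem' := by
    rintro c p ⟨f, hf, hf1, hf2⟩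
    refine ⟨c • f, hf.subset (Function.support_const_smul_subset c f), fun x => ?_, fun x => ?_⟩
    · rw [Prod.smul_fst, G.ae_vertexMeasure (Lp.coeFn_smul c p.1) x, Pi.smul_apply, hf1]
      rfl
    · rw [Prod.smul_snd, G.ae_vertexMeasure (Lp.coeFn_smul c p.2) x, Pi.smul_apply, hf2,
        laplacian_smul]
      rfl

theorem finite_large (hm : ∃ c > 0, ∀ x, c ≤ G.m x) (h : G.L2) {a : ℝ} (ha : 0 < a) :
    {x | a ≤ ‖h x‖}.Finite := by
  obtain ⟨c, hc, hcm⟩ := hm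
  have hμ : G.vertexMeasure {x | a ≤ ‖h x‖} < ⊤ := by
    have := (Lp.memLp h).meas_ge_lt_top (ε := ⟨a, ha.le⟩) (by simp) (by simp)
      (by intro h0; exact ha.ne' (congrArg NNReal.toReal h0))
    exact this
  by_contra hinf
  have hinf : {x | a ≤ ‖h x‖}.Infinite := hinf
  have hbig : ∀ n : ℕ, (n : ENNReal) * ENNReal.ofReal c ≤ G.vertexMeasure {x | a ≤ ‖h x‖} := by
    intro n
    obtain ⟨s, hs, hn⟩ := hinf.exists_subset_card_eq n
    calc (n : ENNReal) * ENNReal.ofReal c = ∑ x ∈ s, ENNReal.ofReal c := by simp [hn]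
      _ ≤ ∑ x ∈ s, G.vertexMeasure {x} := Finset.sum_le_sum fun x _ => by
          rw [G.vertexMeasure_singleton]; exact ENNReal.ofReal_le_ofReal (hcm x)
      _ = G.vertexMeasure s := by simp
      _ ≤ _ := measure_mono hs
  have hc0 : ENNReal.ofReal c ≠ 0 := by simpa using hc
  obtain ⟨n, hn⟩ := ENNReal.exists_nat_gt
    (ENNReal.div_lt_top hμ.ne hc0).ne
  rw [ENNReal.div_lt_iff (Or.inl hc0) (Or.inl ENNReal.ofReal_ne_top)] at hn
  exact absurd (hbig n) (not_le.2 hn)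

/-- If the vertex weights are bounded below by a positive constant, in particular for the counting
measure, the heat semigroup exists. -/
theorem exists_isHeatSemigroup (hm : ∃ c > 0, ∀ x, c ≤ G.m x) :
    ∃ T, G.IsHeatSemigroup T := by
  classical
  let single : X → X → ℂ := fun x => Pi.single x 1
  have hsing : ∀ x, (single x).support ⊆ {x} := fun x => by
    simp [single]
  have hfin : ∀ x, (single x).support.Finite := fun x =>
    (Set.finite_singleton x).subset (hsing x)
  have elem : ∀ x, ∃ p ∈ G.minimalLaplacianGraph, (∀ z, p.1 z = single x z) ∧
      ∀ z, p.2 z = G.laplacian (single x) z := fun x => by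
    obtain ⟨u, hu⟩ := G.exists_L2 (hfin x)
    obtain ⟨v, hv⟩ := G.exists_L2 (G.laplacian_support_finite (hfin x))
    exact ⟨(u, v), ⟨single x, hfin x, hu, hv⟩, hu, hv⟩
  have innerSingle : ∀ (h u : G.L2) x, (∀ z, u z = single x z) →
      inner ℂ h u = (G.m x : ℂ) * star (h x) := fun h u x hu => by
    rw [G.inner_eq_sum h u {x} (fun z hz => by
      rw [hu]; exact Pi.single_eq_of_ne (by simpa using hz) _)]
    simp [hu, single]
  refine (exists_semigroup_of_graph G.minimalLaplacianSubmodule ?_ ?_ ?_ ?_).imp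
    fun T h => ⟨h.1, h.2⟩
  · rintro p ⟨f, hf, hf1, hf2⟩ q ⟨g, hg, hg1, hg2⟩
    obtain ⟨s, h1, h2⟩ := G.exists_nbhd (hf.union hg)
    have a1 : f.support ⊆ s := Set.subset_union_left.trans h1
    have a2 : g.support ⊆ s := Set.subset_union_right.trans h1
    have b1 := fun x (hx : x ∈ f.support) => h2 x (Or.inl hx)
    have b2 := fun x (hx : x ∈ g.support) => h2 x (Or.inr hx)
    rw [G.inner_laplacian p.1 q.2 a2 b2 hg2, ← inner_conj_symm,
      G.inner_laplacian q.1 p.2 a1 b1 hf2, map_mul, map_sum]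
    congr 1
    · rw [show (1 / 2 : ℂ) = ((1 / 2 : ℝ) : ℂ) by push_cast; rfl, Complex.conj_ofReal]
    · refine Finset.sum_congr rfl fun x _ => ?_
      rw [map_sum]
      refine Finset.sum_congr rfl fun y _ => ?_
      simp only [hf1, hg1, map_mul, map_sub, Complex.conj_ofReal, Complex.star_def,
        Complex.conj_conj]
      ring
  · rintro p ⟨f, hf, hf1, hf2⟩
    obtain ⟨s, h1, h2⟩ := G.exists_nbhd hf
    rw [G.inner_laplacian p.1 p.2 h1 h2 hf2]
    have : (1 / 2 * ∑ x ∈ s, ∑ y ∈ s,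
        (G.b x y : ℂ) * ((star (p.1 x) - star (p.1 y)) * (f x - f y))) =
        ((1 / 2 * ∑ x ∈ s, ∑ y ∈ s, G.b x y * Complex.normSq (f x - f y) : ℝ) : ℂ) := by
      push_cast
      congr 1
      refine Finset.sum_congr rfl fun x _ => Finset.sum_congr rfl fun y _ => ?_
      rw [hf1, hf1, ← star_sub, Complex.normSq_eq_conj_mul_self]
      rfl
    rw [this, Complex.ofReal_re]
    have : 0 ≤ ∑ x ∈ s, ∑ y ∈ s, G.b x y * Complex.normSq (f x - f y) :=
      Finset.sum_nonneg fun x _ => Finset.sum_nonneg fun y _ =>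
        mul_nonneg (G.b_nonneg x y) (Complex.normSq_nonneg _)
    linarith
  · let N := G.minimalLaplacianSubmodule.map (LinearMap.fst ℂ G.L2 G.L2)
    have hN : (N : Set G.L2) = Prod.fst '' (G.minimalLaplacianSubmodule : Set (G.L2 × G.L2)) := rfl
    rw [← hN, Submodule.dense_iff_topologicalClosure_eq_top, Submodule.topologicalClosure_eq_top_iff,
      Submodule.eq_bot_iff]
    intro h hh
    refine G.ext_L2 fun x => ?_
    obtain ⟨p, hp, hp1, -⟩ := elem x
    have := (Submodule.mem_orthogonal' N h).1 hh p.1 ⟨p, hp, rfl⟩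
    rw [innerSingle h p.1 x hp1] at this
    have hmx : (G.m x : ℂ) ≠ 0 := by exact_mod_cast (G.m_pos x).ne'
    rw [G.ae_vertexMeasure (Lp.coeFn_zero ℂ 2 _) x]
    simpa [hmx] using this
  · let N := G.minimalLaplacianSubmodule.map
      (LinearMap.fst ℂ G.L2 G.L2 + LinearMap.snd ℂ G.L2 G.L2)
    have hN : (N : Set G.L2) = (fun p : G.L2 × G.L2 => p.1 + p.2) ''
      (G.minimalLaplacianSubmodule : Set (G.L2 × G.L2)) := rfl
    rw [← hN, Submodule.dense_iff_topologicalClosure_eq_top, Submodule.topologicalClosure_eq_top_iff,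
      Submodule.eq_bot_iff]
    intro h hh
    have key : ∀ x, ∃ s : Finset X, (G.m x : ℂ) * star (h x) +
        ∑ y ∈ s, (G.b x y : ℂ) * (star (h x) - star (h y)) = 0 := by
      intro x
      obtain ⟨p, hp, hp1, hp2⟩ := elem x
      have e := (Submodule.mem_orthogonal' N h).1 hh (p.1 + p.2) ⟨p, hp, rfl⟩
      obtain ⟨s, h1, h2⟩ := G.exists_nbhd (Set.finite_singleton x)
      have hxs : x ∈ s := h1 rfl
      refine ⟨s, ?_⟩
      rw [inner_add_right, innerSingle h p.1 x hp1, G.inner_laplacian h p.2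
        ((hsing x).trans h1) (fun z hz => h2 z (hsing x hz)) hp2] at e
      have e2 : 1 / 2 * ∑ z ∈ s, ∑ y ∈ s, (G.b z y : ℂ) *
          ((star (h z) - star (h y)) * (single x z - single x y)) =
          ∑ y ∈ s, (G.b x y : ℂ) * (star (h x) - star (h y)) := by
        have := G.sum_green s (single x) (fun z => star (h z))
        rw [Finset.sum_eq_single x (fun z _ hz => by simp [single, hz])
          (fun hx => absurd hxs hx)] at this
        simp only [single, Pi.single_eq_same, one_mul] at this
        rw [this]
        congr 1
        refine Finset.sum_congr rfl fun z _ => Finset.sum_congr rfl fun y _ => ?_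
        ring
      rw [← e2]; exact e
    by_contra hne
    obtain ⟨x₀, hx₀⟩ : ∃ x, h x ≠ 0 := by
      by_contra hall
      push Not at hall
      exact hne (G.ext_L2 fun x => by
        rw [hall x, G.ae_vertexMeasure (Lp.coeFn_zero ℂ 2 _) x]; rfl)
    have hF := G.finite_large hm h (norm_pos_iff.2 hx₀)
    obtain ⟨x, hx, hmax⟩ := hF.exists_maximalFor (fun x => ‖h x‖) _ ⟨x₀, le_refl ‖h x₀‖⟩
    have hle : ∀ y, ‖h y‖ ≤ ‖h x‖ := fun y => by
      rcases le_total ‖h x‖ ‖h y‖ with hy | hy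
      · exact hmax (show ‖h x₀‖ ≤ ‖h y‖ from le_trans hx hy) hy
      · exact hy
    obtain ⟨s, hs⟩ := key x
    have e1 : ((G.m x + ∑ y ∈ s, G.b x y : ℝ) : ℂ) * star (h x) =
        ∑ y ∈ s, (G.b x y : ℂ) * star (h y) := by
      push_cast
      simp only [mul_sub, Finset.sum_sub_distrib, ← Finset.sum_mul] at hs
      linear_combination hs
    have hB : 0 ≤ ∑ y ∈ s, G.b x y := Finset.sum_nonneg fun y _ => G.b_nonneg x y
    have e3 : (G.m x + ∑ y ∈ s, G.b x y) * ‖h x‖ ≤ (∑ y ∈ s, G.b x y) * ‖h x‖ := by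
      have := congrArg norm e1
      rw [norm_mul, norm_star, Complex.norm_real,
        Real.norm_of_nonneg (add_nonneg (G.m_pos x).le hB)] at this
      rw [this, Finset.sum_mul]
      refine norm_sum_le_of_le _ fun y _ => ?_
      rw [norm_mul, norm_star, Complex.norm_real, Real.norm_of_nonneg (G.b_nonneg x y)]
      exact mul_le_mul_of_nonneg_left (hle y) (G.b_nonneg x y)
    have hpos : 0 < ‖h x‖ := lt_of_lt_of_le (norm_pos_iff.2 hx₀) hx
    nlinarith [mul_pos (G.m_pos x) hpos]

end Existence

end WeightedGraph

/-!
The proof is Davies' exponential perturbation method. Fix a test function `ψ` and `l : ℝ`, and let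
`N` be multiplication by `exp (l ψ)`. This is a bounded operator on `ℓ²(X,m)`, because `ψ` takes
only finitely many values.

On finitely supported `f`, Green's formula writes `Re ⟨N f, N Δ f⟩` as a sum over edges. The term
of the edge `{x, y}` is bounded below by the values of `|N f|²` at `x` and `y`, multiplied by
`-b(x,y) (cosh (l (ψ x - ψ y)) - 1)`. Regularity gives `|ψ x - ψ y| ≤ S` there, and
`(cosh r - 1) / r ^ 2` increases for `r ≥ 0`, so that `Γ(ψ) ≤ 1` yields
`Re ⟨N f, N Δ f⟩ ≥ -c ‖N f‖²` with `c = 2 (cosh (l S) - 1) / S ^ 2`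
(`WeightedGraph.weighted_form_ge_of_mem_minimalLaplacianGraph`). Both sides are continuous in
`(f, Δ f)`, hence the bound holds on the whole domain of the closure, and a Gronwall argument
gives `‖N exp (-tΔ) f‖ ≤ exp (c t) ‖N f‖` on that domain
(`IsC0Semigroup.norm_apply_le_of_weighted_form_ge`). For `f = δ_y`, pairing with `δ_x` shows
`p_t(x,y) ≤ exp (c t - l (ψ x - ψ y)) / √(m x m y)`.

Taking the supremum over `ψ` replaces `ψ x - ψ y` by Davies' metric `ρ`
(`WeightedGraph.heatKernel_le_exp_daviesMetric`). Put `r = ρ S / (2 t)`. The choice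
`l S = arsinh r` is optimal and gives the exponent with `zeta`. The choice `l S = r`, together with
`cosh r - 1 ≤ r ^ 2 / 2 + r ^ 4 / 4`, gives the Gaussian bound for small `r`.
-/

/-! ### Energy estimates for strongly continuous semigroups -/

namespace IsC0Semigroup

variable {H : Type*} [NormedAddCommGroup H] [InnerProductSpace ℂ H] {T : ℝ → H →L[ℂ] H}

theorem commute (hT : IsC0Semigroup T) {s t : ℝ} (hs : 0 ≤ s) (ht : 0 ≤ t) (u : H) :
    T s (T t u) = T t (T s u) := by
  have h1 := hT.add s t hs ht
  rw [add_comm, hT.add t s ht hs] at h1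
  exact (DFunLike.congr_fun h1 u).symm

theorem mem_generatorGraph_apply (hT : IsC0Semigroup T) {u v : H} (h : (u, v) ∈ generatorGraph T)
    {t : ℝ} (ht : 0 ≤ t) : (T t u, T t v) ∈ generatorGraph T := by
  refine (((T t).continuous.tendsto v).comp h).congr' ?_
  filter_upwards [self_mem_nhdsWithin] with s hs
  simp only [Function.comp_apply, map_smul, map_sub]
  rw [hT.commute ht (le_of_lt hs)]

theorem hasDerivWithinAt (hT : IsC0Semigroup T) {u v : H} (h : (u, v) ∈ generatorGraph T)
    {t : ℝ} (ht : 0 ≤ t) : HasDerivWithinAt (fun s => T s u) (T t v) (Set.Ici t) t := by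
  rw [← hasDerivWithinAt_Ioi_iff_Ici, hasDerivWithinAt_iff_tendsto_slope' Set.self_notMem_Ioi]
  have h1 : Tendsto (fun s : ℝ => s - t) (𝓝[>] t) (𝓝[>] 0) := by
    refine tendsto_nhdsWithin_iff.2 ⟨?_, ?_⟩
    · have : Tendsto (fun s : ℝ => s - t) (𝓝 t) (𝓝 (t - t)) :=
        (continuous_id.sub continuous_const).tendsto t
      rw [sub_self] at this
      exact this.mono_left nhdsWithin_le_nhds
    · filter_upwards [self_mem_nhdsWithin] with s hs
      exact Set.mem_Ioi.2 (sub_pos.2 (Set.mem_Ioi.1 hs))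
  refine ((hT.mem_generatorGraph_apply h ht).comp h1).congr' ?_
  filter_upwards [self_mem_nhdsWithin] with s hs
  have h2 : T s u = T (s - t) (T t u) := by
    rw [← ContinuousLinearMap.comp_apply, ← hT.add _ _ (sub_nonneg.2 (le_of_lt hs)) ht,
      sub_add_cancel]
  rw [slope_def_module, Function.comp_apply, h2, ← Complex.ofReal_inv, Complex.coe_smul]

/-- A strongly continuous semigroup is bounded near `0`: otherwise some sequence `t n → 0` would
contradict the uniform boundedness principle. -/
theorem exists_bound_near_zero [CompleteSpace H] (hT : IsC0Semigroup T) :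
    ∃ δ > 0, ∃ M, 1 ≤ M ∧ ∀ t, 0 ≤ t → t ≤ δ → ‖T t‖ ≤ M := by
  by_contra! hcon
  have hseq : ∀ n : ℕ, ∃ t : ℝ, 0 ≤ t ∧ t ≤ 1 / ((n : ℝ) + 1) ∧ (n : ℝ) + 1 < ‖T t‖ := fun n =>
    hcon _ Nat.one_div_pos_of_nat _ (by simp)
  choose t ht0 htn htM using hseq
  have ht : Tendsto t atTop (𝓝[≥] 0) := tendsto_nhdsWithin_iff.2
    ⟨squeeze_zero ht0 htn tendsto_one_div_add_atTop_nhds_zero_nat, Eventually.of_forall ht0⟩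
  obtain ⟨C, hC⟩ := banach_steinhaus (g := fun n => T (t n)) fun u => by
    have hu : Tendsto (fun s => T s u) (𝓝[≥] 0) (𝓝 u) := by
      have h0 : T 0 u = u := by rw [hT.zero]; rfl
      have h1 : ContinuousWithinAt (fun s => T s u) (Set.Ioi 0) 0 := by
        rw [ContinuousWithinAt, h0]; exact hT.tendsto_zero u
      simpa [ContinuousWithinAt, h0] using continuousWithinAt_Ioi_iff_Ici.1 h1
    obtain ⟨C, hC⟩ := (hu.comp ht).norm.bddAbove_range
    exact ⟨C, fun n => hC ⟨n, rfl⟩⟩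
  obtain ⟨n, hn⟩ := exists_nat_gt C
  linarith [hC n, htM n]

theorem exists_bound [CompleteSpace H] (hT : IsC0Semigroup T) (b : ℝ) :
    ∃ M, ∀ t, 0 ≤ t → t ≤ b → ‖T t‖ ≤ M := by
  obtain ⟨δ, hδ, M, hM1, hM⟩ := hT.exists_bound_near_zero
  have key : ∀ n : ℕ, ∀ t, 0 ≤ t → t ≤ n * δ → ‖T t‖ ≤ M ^ (n + 1) := by
    intro n
    induction n with
    | zero => exact fun t h0 h1 => by simpa using hM t h0 (by simp at h1; linarith)
    | succ n ih =>
      intro t h0 h1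
      push_cast at h1
      rcases le_total t δ with h | h
      · exact (hM t h0 h).trans (le_self_pow₀ hM1 (by omega))
      · have e : T t = T δ ∘L T (t - δ) := by
          rw [← hT.add _ _ hδ.le (sub_nonneg.2 h), add_sub_cancel]
        rw [e, pow_succ']
        refine (ContinuousLinearMap.opNorm_comp_le _ _).trans ?_
        have := ih (t - δ) (sub_nonneg.2 h) (by linarith)
        gcongr
        exact hM δ hδ.le le_rfl
  obtain ⟨n, hn⟩ := exists_nat_ge (b / δ)
  exact ⟨_, fun t h0 h1 => key n t h0 (h1.trans ((div_le_iff₀ hδ).1 hn))⟩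

/-- Orbits of points of the domain of the generator are continuous. On the left of a point this is
not part of the derivative statement; it uses the bound on compact time intervals. -/
theorem continuousOn_orbit [CompleteSpace H] (hT : IsC0Semigroup T) {u v : H}
    (h : (u, v) ∈ generatorGraph T) (b : ℝ) : ContinuousOn (fun s => T s u) (Set.Icc 0 b) := by
  intro t ht
  obtain ⟨M, hM⟩ := hT.exists_bound b
  have hr : ContinuousWithinAt (fun s => T s u) (Set.Ici t) t :=
    (hT.hasDerivWithinAt h ht.1).continuousWithinAt
  have h0 : Tendsto (fun s => T s u - u) (𝓝[≥] 0) (𝓝 0) := by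
    have h1 := (hT.hasDerivWithinAt h le_rfl).continuousWithinAt.tendsto.sub_const u
    simpa [hT.zero] using h1
  have hl : ContinuousWithinAt (fun s => T s u) (Set.Icc 0 t) t := by
    have h1 : Tendsto (fun s : ℝ => t - s) (𝓝[Set.Icc 0 t] t) (𝓝[≥] 0) := by
      refine tendsto_nhdsWithin_iff.2 ⟨?_, ?_⟩
      · have : Tendsto (fun s : ℝ => t - s) (𝓝 t) (𝓝 (t - t)) :=
          (continuous_const.sub continuous_id).tendsto t
        rw [sub_self] at this
        exact this.mono_left nhdsWithin_le_nhds
      · filter_upwards [self_mem_nhdsWithin] with s hs using sub_nonneg.2 hs.2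
    rw [ContinuousWithinAt, tendsto_iff_norm_sub_tendsto_zero]
    refine squeeze_zero' (Eventually.of_forall fun _ => norm_nonneg _) ?_
      (by simpa using ((h0.comp h1).norm.const_mul M))
    filter_upwards [self_mem_nhdsWithin] with s hs
    have e : T t u = T s (T (t - s) u) := by
      rw [← ContinuousLinearMap.comp_apply, ← hT.add _ _ hs.1 (sub_nonneg.2 hs.2), add_sub_cancel]
    rw [e, norm_sub_rev, ← map_sub]
    exact (T s).le_of_opNorm_le (hM s hs.1 (hs.2.trans ht.2)) _
  refine (hl.union hr).mono fun s hs => ?_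
  rcases le_total s t with hst | hst
  · exact Or.inl ⟨hs.1, hst⟩
  · exact Or.inr hst

/-- If the generator `-A` satisfies `Re ⟨N u, N A u⟩ ≥ -c ‖N u‖²` on its domain, then the weighted
norm `‖N u‖` grows at most like `exp (c t)` along the orbits of the semigroup. -/
theorem norm_apply_le_of_weighted_form_ge [CompleteSpace H] (hT : IsC0Semigroup T) (N : H →L[ℂ] H)
    {c : ℝ} (hN : ∀ u v, (u, -v) ∈ generatorGraph T → -(c * ‖N u‖ ^ 2) ≤ (inner ℂ (N u) (N v)).re)
    {u v : H} (h : (u, -v) ∈ generatorGraph T) {t : ℝ} (ht : 0 ≤ t) :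
    ‖N (T t u)‖ ≤ Real.exp (c * t) * ‖N u‖ := by
  have hsq : ∀ w : H, (inner ℂ w w).re = ‖w‖ ^ 2 := fun w => inner_self_eq_norm_sq (𝕜 := ℂ) w
  have hre : ∀ w z : H, (inner ℂ w z).re = (inner ℂ z w).re := fun w z =>
    inner_re_symm (𝕜 := ℂ) w z
  have hderiv : ∀ s ∈ Set.Ico 0 t, HasDerivWithinAt
      (fun s => Real.exp (-(2 * c * s)) * (inner ℂ (N (T s u)) (N (T s u))).re)
      (Real.exp (-(2 * c * s)) * -(2 * c) * (inner ℂ (N (T s u)) (N (T s u))).re +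
        Real.exp (-(2 * c * s)) * (inner ℂ (N (T s u)) (N (T s (-v))) +
          inner ℂ (N (T s (-v))) (N (T s u))).re) (Set.Ici s) s := by
    intro s hs
    have h1 : HasDerivWithinAt (fun s => N (T s u)) (N (T s (-v))) (Set.Ici s) s :=
      (N.restrictScalars ℝ).hasFDerivAt.comp_hasDerivWithinAt s (hT.hasDerivWithinAt h hs.1)
    have h2 := Complex.reCLM.hasFDerivAt.comp_hasDerivWithinAt s (h1.inner ℂ h1)
    have h3 : HasDerivAt (fun s : ℝ => Real.exp (-(2 * c * s)))
        (Real.exp (-(2 * c * s)) * -(2 * c)) s := by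
      simpa using (((hasDerivAt_id s).const_mul (2 * c)).neg).exp
    exact h3.hasDerivWithinAt.mul h2
  have hcont : ContinuousOn
      (fun s => Real.exp (-(2 * c * s)) * (inner ℂ (N (T s u)) (N (T s u))).re) (Set.Icc 0 t) := by
    have h1 := N.continuous.comp_continuousOn (hT.continuousOn_orbit h t)
    exact (by fun_prop : Continuous fun s : ℝ => Real.exp (-(2 * c * s))).continuousOn.mul
      (Complex.continuous_re.comp_continuousOn (h1.inner h1))
  have hmain := image_le_of_deriv_right_le_deriv_boundary hcont hderiv
    (B := fun _ => ‖N u‖ ^ 2) (B' := fun _ => 0)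
    (by simp [hT.zero, ← hsq]) continuousOn_const
    (fun s _ => hasDerivWithinAt_const _ _ _) (fun s hs => by
      have h4 := hN (T s u) (T s v) (by
        rw [← map_neg]; exact hT.mem_generatorGraph_apply h hs.1)
      rw [Complex.add_re, hre (N (T s (-v))), hsq, map_neg, map_neg, inner_neg_right,
        Complex.neg_re]
      nlinarith [Real.exp_pos (-(2 * c * s))]) (Set.right_mem_Icc.2 ht)
  rw [hsq, Real.exp_neg, inv_mul_le_iff₀ (Real.exp_pos _)] at hmain
  refine abs_le_of_sq_le_sq' ?_ (by positivity) |>.2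
  rwa [mul_pow, ← Real.exp_nat_mul, Nat.cast_ofNat, ← mul_assoc]

end IsC0Semigroup

/-! ### Estimates for the hyperbolic cosine -/

theorem Real.cosh_mul_sub_one_le {θ : ℝ} (hθ : |θ| ≤ 1) (x : ℝ) :
    Real.cosh (θ * x) - 1 ≤ θ ^ 2 * (Real.cosh x - 1) := by
  -- the inequality holds for each term of the power series
  have h1 := (hasSum_nat_add_iff' 1).2 (Real.hasSum_cosh (θ * x))
  have h2 := ((hasSum_nat_add_iff' 1).2 (Real.hasSum_cosh x)).mul_left (θ ^ 2)
  simp only [Finset.sum_range_one, mul_zero, pow_zero, Nat.factorial_zero, Nat.cast_one,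
    div_one] at h1 h2
  refine hasSum_le (fun n => ?_) h1 h2
  have h3 : θ ^ 2 ≤ 1 := (sq_le_one_iff_abs_le_one θ).2 hθ
  rw [← mul_div_assoc]
  gcongr
  rw [pow_mul, pow_mul, mul_pow, mul_pow, pow_succ (θ ^ 2), mul_assoc, mul_comm (θ ^ 2)]
  have h4 : (θ ^ 2) ^ n ≤ 1 := pow_le_one₀ (sq_nonneg θ) h3
  have h5 : 0 ≤ (x ^ 2) ^ (n + 1) * θ ^ 2 := by positivity
  nlinarith [mul_le_mul_of_nonneg_right h4 h5]

theorem Real.cosh_sub_one_le {x : ℝ} (hx : x ^ 2 ≤ 2) :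
    Real.cosh x - 1 ≤ x ^ 2 / 2 + x ^ 4 / 4 := by
  have h1 := Real.abs_exp_sub_one_sub_id_le (x := x ^ 2 / 2)
    (by rw [abs_of_nonneg (by positivity)]; linarith)
  have h2 := Real.cosh_le_exp_half_sq x
  have h3 := (abs_le.1 h1).2
  have h4 : (x ^ 2 / 2) ^ 2 = x ^ 4 / 4 := by ring
  linarith

/-! ### Multiplication operators -/

namespace WeightedGraph

section Multiplication

variable {X : Type*} (G : WeightedGraph X) [MeasurableSpace X] [DiscreteMeasurableSpace X]

/-- Bounded functions act on `ℓ²(X,m)` by pointwise multiplication. -/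
theorem exists_mul_clm {φ : X → ℝ} {C : ℝ} (hφ : ∀ x, |φ x| ≤ C) :
    ∃ N : G.L2 →L[ℂ] G.L2, ∀ u x, N u x = φ x * u x := by
  have hle : ∀ (u : G.L2) x, ‖(φ x : ℂ) * u x‖ ≤ C * ‖u x‖ := fun u x => by
    rw [norm_mul, Complex.norm_real, Real.norm_eq_abs]
    exact mul_le_mul_of_nonneg_right (hφ x) (norm_nonneg _)
  have hmem : ∀ u : G.L2, MemLp (fun x => (φ x : ℂ) * u x) 2 G.vertexMeasure := fun u =>
    (Lp.memLp u).of_le_mul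
      ((Measurable.of_discrete (f := fun x => (φ x : ℂ))).aestronglyMeasurable.mul
        (Lp.aestronglyMeasurable u)) (ae_of_all _ (hle u))
  have hval : ∀ (u : G.L2) x, ((hmem u).toLp : G.L2) x = (φ x : ℂ) * u x := fun u =>
    G.ae_vertexMeasure (hmem u).coeFn_toLp
  refine ⟨LinearMap.mkContinuous
    { toFun := fun u => (hmem u).toLp
      map_add' := fun u v => G.ext_L2 fun x => ?_
      map_smul' := fun c u => G.ext_L2 fun x => ?_ } C fun u =>
        Lp.norm_le_mul_norm_of_ae_le_mul (ae_of_all _ fun x => ?_), fun u x => hval u x⟩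
  · rw [hval, G.ae_vertexMeasure (Lp.coeFn_add u v) x,
      G.ae_vertexMeasure (Lp.coeFn_add (hmem u).toLp (hmem v).toLp) x, Pi.add_apply, Pi.add_apply,
      hval, hval, mul_add]
  · rw [hval, G.ae_vertexMeasure (Lp.coeFn_smul c u) x, RingHom.id_apply,
      G.ae_vertexMeasure (Lp.coeFn_smul c (hmem u).toLp) x, Pi.smul_apply, Pi.smul_apply, hval,
      smul_eq_mul, smul_eq_mul, mul_left_comm]
  · change ‖((hmem u).toLp : G.L2) x‖ ≤ _
    rw [hval]
    exact hle u x

theorem inner_delta_left (x : X) (u : G.L2) : inner ℂ (G.delta x) u = G.m x * u x := by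
  rw [delta, L2.inner_indicatorConstLp_one, Measure.restrict_singleton, integral_smul_measure,
    integral_dirac, G.vertexMeasure_singleton, ENNReal.toReal_ofReal (G.m_pos x).le,
    Complex.real_smul]

theorem norm_delta (x : X) : ‖G.delta x‖ = √(G.m x) := by
  rw [delta, norm_indicatorConstLp (by simp) (by simp), Measure.real, G.vertexMeasure_singleton,
    ENNReal.toReal_ofReal (G.m_pos x).le, Real.sqrt_eq_rpow]
  simp

open Classical in
theorem delta_apply (x z : X) : G.delta x z = Pi.single (M := fun _ => ℂ) x 1 z := by
  rw [delta, G.ae_vertexMeasure indicatorConstLp_coeFn z, Set.indicator_apply, Pi.single_apply]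
  rfl

theorem exists_delta_mem_minimalLaplacianGraph (x : X) :
    ∃ v, (G.delta x, v) ∈ G.minimalLaplacianGraph := by
  classical
  have hfin : (Pi.single (M := fun _ => ℂ) x 1).support.Finite :=
    (Set.finite_singleton x).subset (by simp)
  obtain ⟨v, hv⟩ := G.exists_L2 (G.laplacian_support_finite hfin)
  exact ⟨v, _, hfin, G.delta_apply x, hv⟩

end Multiplication

/-! ### The form bound for exponential weights -/

section FormBound

variable {X : Type*} (G : WeightedGraph X)

/-- The estimate on one edge: `p` and `q` are the values of the weight `exp (l ψ)` at its end
points, and `k` is the hyperbolic cosine of the increment of `l ψ`. -/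
theorem re_weighted_edge_ge {p q k : ℝ} (hp : 0 < p) (hq : 0 < q)
    (hk : p / q + q / p = 2 * k) (hk1 : 1 ≤ k) (z w : ℂ) :
    -((k - 1) * (‖p * z‖ ^ 2 + ‖q * w‖ ^ 2)) ≤
      ((star (p * (p * z)) - star (q * (q * w))) * (z - w)).re := by
  have hpq : p ^ 2 + q ^ 2 = 2 * k * (p * q) := by
    rw [← hk]; field_simp
  simp only [← Complex.normSq_eq_norm_sq, Complex.normSq_apply, Complex.star_def, map_mul,
    Complex.conj_ofReal, Complex.mul_re, Complex.mul_im, Complex.sub_re, Complex.sub_im,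
    Complex.ofReal_re, Complex.ofReal_im, Complex.conj_re, Complex.conj_im]
  have h1 := mul_nonneg (by linarith : 0 ≤ k) (sq_nonneg (p * z.re - q * w.re))
  have h2 := mul_nonneg (by linarith : 0 ≤ k) (sq_nonneg (p * z.im - q * w.im))
  linear_combination h1 + h2 + (z.re * w.re + z.im * w.im) * hpq

theorem IsTestFunction.neg {ψ : X → ℝ} (hψ : G.IsTestFunction ψ) :
    G.IsTestFunction fun x => -ψ x := by
  refine ⟨by simpa [Function.support] using hψ.1, fun x => ?_⟩
  have h := hψ.2 x
  simp only [energyMeasure] at h ⊢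
  convert h using 5
  ring

theorem IsTestFunction.sum_le {ψ : X → ℝ} (hψ : G.IsTestFunction ψ) (s : Finset X) (x : X) :
    ∑ y ∈ s, G.b x y * (ψ x - ψ y) ^ 2 ≤ 2 * G.m x := by
  have h1 := hψ.2 x
  have hm := G.m_pos x
  have hsum : Summable fun y => G.b x y * ((ψ x - ψ y) * (ψ x - ψ y)) := by
    refine summable_of_hasFiniteSupport ((G.locallyFinite x).subset fun y hy => ?_)
    rcases (G.b_nonneg x y).eq_or_lt with h | h
    · exact absurd (by simp [← h]) hy
    · exact h
  rw [energyMeasure, one_div, inv_mul_le_iff₀ (by positivity), mul_one] at h1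
  refine le_trans ?_ h1
  simp only [sq]
  exact hsum.sum_le_tsum s fun y _ => mul_nonneg (G.b_nonneg x y) (mul_self_nonneg _)

variable {G}

/-- Since `(cosh r - 1) / r ^ 2` is increasing for `r ≥ 0`, regularity bounds the cosh-increments of
`l * ψ` over the edges at `x` by the energy measure of `ψ`. -/
theorem IsTestFunction.sum_cosh_le {ψ : X → ℝ} (hψ : G.IsTestFunction ψ) {S : ℝ} (hS : 0 < S)
    (hG : G.IsRegular S) (l : ℝ) (s : Finset X) (x : X) :
    ∑ y ∈ s, G.b x y * (Real.cosh (l * (ψ x - ψ y)) - 1) ≤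
      2 * (Real.cosh (l * S) - 1) / S ^ 2 * G.m x := by
  have hc : 0 ≤ (Real.cosh (l * S) - 1) / S ^ 2 :=
    div_nonneg (sub_nonneg.2 (Real.one_le_cosh _)) (sq_nonneg S)
  calc _ ≤ ∑ y ∈ s, (Real.cosh (l * S) - 1) / S ^ 2 * (G.b x y * (ψ x - ψ y) ^ 2) := by
        refine Finset.sum_le_sum fun y _ => ?_
        rcases (G.b_nonneg x y).eq_or_lt with h | h
        · simp [← h]
        · have h1 : |(ψ x - ψ y) / S| ≤ 1 := by
            rw [abs_div, abs_of_pos hS]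
            exact div_le_one_of_le₀ (hG ψ hψ x y h) hS.le
          have h2 := Real.cosh_mul_sub_one_le h1 (l * S)
          rw [show (ψ x - ψ y) / S * (l * S) = l * (ψ x - ψ y) by field_simp] at h2
          refine (mul_le_mul_of_nonneg_left h2 h.le).trans (le_of_eq ?_)
          ring
    _ = (Real.cosh (l * S) - 1) / S ^ 2 * ∑ y ∈ s, G.b x y * (ψ x - ψ y) ^ 2 := by
        rw [Finset.mul_sum]
    _ ≤ (Real.cosh (l * S) - 1) / S ^ 2 * (2 * G.m x) :=
        mul_le_mul_of_nonneg_left (hψ.sum_le G s x) hc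
    _ = _ := by ring

variable [MeasurableSpace X] [DiscreteMeasurableSpace X]

/-- Green's formula reduces the form to edges; each edge is bounded below by the weight of its two
end points times a cosh-increment, and the increments at one vertex add up to at most `c m(x)`. -/
theorem weighted_form_ge_of_mem_minimalLaplacianGraph {ψ : X → ℝ} (hψ : G.IsTestFunction ψ) {S : ℝ}
    (hS : 0 < S) (hG : G.IsRegular S) (l : ℝ) {N : G.L2 →L[ℂ] G.L2}
    (hN : ∀ u x, N u x = Real.exp (l * ψ x) * u x) {p : G.L2 × G.L2}
    (hp : p ∈ G.minimalLaplacianGraph) :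
    -(2 * (Real.cosh (l * S) - 1) / S ^ 2 * ‖N p.1‖ ^ 2) ≤ (inner ℂ (N p.1) (N p.2)).re := by
  obtain ⟨f, hf, hf1, hf2⟩ := hp
  obtain ⟨s, h1, h2⟩ := G.exists_nbhd hf
  set φ : X → ℝ := fun x => Real.exp (l * ψ x) with hφ
  set K : X → X → ℝ := fun x y => Real.cosh (l * (ψ x - ψ y)) - 1 with hK
  have hK0 : ∀ x y, 0 ≤ K x y := fun x y => sub_nonneg.2 (Real.one_le_cosh _)
  have hKs : ∀ x y, K x y = K y x := fun x y => by
    simp only [hK]; rw [← Real.cosh_neg]; ring_nf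
  have hnorm : ‖N p.1‖ ^ 2 = ∑ x ∈ s, G.m x * ‖(φ x : ℂ) * f x‖ ^ 2 := by
    have h3 : (inner ℂ (N p.1) (N p.1)).re = ‖N p.1‖ ^ 2 := inner_self_eq_norm_sq (𝕜 := ℂ) _
    rw [← h3, G.inner_eq_sum (N p.1) (N p.1) s fun x hx => by
      rw [hN, hf1, Function.notMem_support.1 fun h => hx (h1 h), mul_zero], Complex.re_sum]
    refine Finset.sum_congr rfl fun x _ => ?_
    rw [hN, hf1, Complex.re_ofReal_mul, Complex.star_def, ← Complex.normSq_eq_conj_mul_self,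
      Complex.ofReal_re, Complex.normSq_eq_norm_sq]
  have hform : (inner ℂ (N p.1) (N p.2)).re = 1 / 2 * ∑ x ∈ s, ∑ y ∈ s, G.b x y *
      ((star (φ x * (φ x * f x) : ℂ) - star (φ y * (φ y * f y) : ℂ)) * (f x - f y)).re := by
    have h0 : ∀ x, x ∉ s → p.2 x = 0 := fun x hx => by rw [hf2, G.laplacian_eq_zero h1 h2 hx]
    have h3 : inner ℂ (N p.1) (N p.2) = inner ℂ (N (N p.1)) p.2 := by
      rw [G.inner_eq_sum _ _ s h0, G.inner_eq_sum _ _ s fun x hx => by rw [hN, h0 x hx, mul_zero]]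
      refine Finset.sum_congr rfl fun x _ => ?_
      simp only [hN, Complex.star_def, map_mul, Complex.conj_ofReal]
      ring
    rw [h3, G.inner_laplacian _ _ h1 h2 hf2, show (1 / 2 : ℂ) = ((1 / 2 : ℝ) : ℂ) by
      push_cast; rfl, Complex.re_ofReal_mul, Complex.re_sum]
    congr 1
    refine Finset.sum_congr rfl fun x _ => ?_
    rw [Complex.re_sum]
    refine Finset.sum_congr rfl fun y _ => ?_
    rw [Complex.re_ofReal_mul, hN, hN, hN, hN, hf1, hf1]
  have hedge : ∀ x y, -(K x y * (‖(φ x : ℂ) * f x‖ ^ 2 + ‖(φ y : ℂ) * f y‖ ^ 2)) ≤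
      ((star (φ x * (φ x * f x) : ℂ) - star (φ y * (φ y * f y) : ℂ)) * (f x - f y)).re :=
    fun x y => re_weighted_edge_ge (Real.exp_pos _) (Real.exp_pos _) (by
      rw [← Real.exp_sub, ← Real.exp_sub, Real.cosh_eq]; ring_nf) (Real.one_le_cosh _) _ _
  have hsym : ∑ x ∈ s, ∑ y ∈ s, G.b x y * K x y * ‖(φ y : ℂ) * f y‖ ^ 2 =
      ∑ x ∈ s, ∑ y ∈ s, G.b x y * K x y * ‖(φ x : ℂ) * f x‖ ^ 2 := by
    rw [Finset.sum_comm]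
    refine Finset.sum_congr rfl fun x _ => Finset.sum_congr rfl fun y _ => ?_
    rw [G.b_symm, hKs]
  have hlow : -(∑ x ∈ s, ∑ y ∈ s, G.b x y * K x y * ‖(φ x : ℂ) * f x‖ ^ 2) ≤
      (inner ℂ (N p.1) (N p.2)).re := by
    have h3 : ∑ x ∈ s, ∑ y ∈ s, -(G.b x y * K x y * ‖(φ x : ℂ) * f x‖ ^ 2 +
        G.b x y * K x y * ‖(φ y : ℂ) * f y‖ ^ 2) ≤ ∑ x ∈ s, ∑ y ∈ s, G.b x y *
        ((star (φ x * (φ x * f x) : ℂ) - star (φ y * (φ y * f y) : ℂ)) * (f x - f y)).re := by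
      refine Finset.sum_le_sum fun x _ => Finset.sum_le_sum fun y _ => ?_
      refine le_trans (le_of_eq ?_) (mul_le_mul_of_nonneg_left (hedge x y) (G.b_nonneg x y))
      ring
    simp only [Finset.sum_neg_distrib, Finset.sum_add_distrib] at h3
    rw [hsym] at h3
    rw [hform]
    linarith
  refine le_trans (neg_le_neg ?_) hlow
  rw [hnorm, Finset.mul_sum]
  refine Finset.sum_le_sum fun x _ => ?_
  rw [← Finset.sum_mul, ← mul_assoc]
  exact mul_le_mul_of_nonneg_right (hψ.sum_cosh_le hS hG l s x) (sq_nonneg _)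

theorem weighted_form_ge_of_mem_closure {ψ : X → ℝ} (hψ : G.IsTestFunction ψ) {S : ℝ}
    (hS : 0 < S) (hG : G.IsRegular S) (l : ℝ) {N : G.L2 →L[ℂ] G.L2}
    (hN : ∀ u x, N u x = Real.exp (l * ψ x) * u x) {p : G.L2 × G.L2}
    (hp : p ∈ closure G.minimalLaplacianGraph) :
    -(2 * (Real.cosh (l * S) - 1) / S ^ 2 * ‖N p.1‖ ^ 2) ≤ (inner ℂ (N p.1) (N p.2)).re := by
  have hclosed : IsClosed {p : G.L2 × G.L2 |
      -(2 * (Real.cosh (l * S) - 1) / S ^ 2 * ‖N p.1‖ ^ 2) ≤ (inner ℂ (N p.1) (N p.2)).re} :=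
    isClosed_le (by fun_prop) (Complex.continuous_re.comp (by fun_prop))
  exact closure_minimal (fun p hp => weighted_form_ge_of_mem_minimalLaplacianGraph hψ hS hG l hN hp)
    hclosed hp

end FormBound

/-! ### Heat kernel bounds -/

section HeatKernel

variable {X : Type*} {G : WeightedGraph X} [MeasurableSpace X] [DiscreteMeasurableSpace X]

/-- Davies' bound for one test function `ψ` and one parameter `l`: the semigroup, conjugated with
multiplication by `exp (l ψ)`, is bounded by `exp (c t)` in operator norm. -/
theorem heatKernel_le_of_isTestFunction {S : ℝ} (hS : 0 < S) (hG : G.IsRegular S)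
    {T : ℝ → G.L2 →L[ℂ] G.L2} (hT : G.IsHeatSemigroup T) {ψ : X → ℝ} (hψ : G.IsTestFunction ψ)
    (l : ℝ) (x y : X) {t : ℝ} (ht : 0 ≤ t) :
    G.heatKernel T t x y ≤ 1 / √(G.m x * G.m y) *
      Real.exp (2 * (Real.cosh (l * S) - 1) / S ^ 2 * t - l * (ψ x - ψ y)) := by
  obtain ⟨C, hC⟩ : ∃ C, ∀ z, |Real.exp (l * ψ z)| ≤ C := by
    have h1 : (Set.range ψ).Finite :=
      ((hψ.1.image ψ).union (Set.finite_singleton 0)).subset fun r ⟨z, hz⟩ => by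
        by_cases h : ψ z = 0
        · exact Or.inr (by rw [← hz, h]; rfl)
        · exact Or.inl ⟨z, h, hz⟩
    obtain ⟨C, hC⟩ := (h1.image fun r => |Real.exp (l * r)|).bddAbove
    exact ⟨C, fun z => hC ⟨ψ z, ⟨z, rfl⟩, rfl⟩⟩
  obtain ⟨N, hN⟩ := G.exists_mul_clm hC
  obtain ⟨v, hv⟩ := G.exists_delta_mem_minimalLaplacianGraph y
  set c := 2 * (Real.cosh (l * S) - 1) / S ^ 2
  have hform : ∀ u w : G.L2, (u, -w) ∈ generatorGraph T →
      -(c * ‖N u‖ ^ 2) ≤ (inner ℂ (N u) (N w)).re := fun u w huw =>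
    weighted_form_ge_of_mem_closure (p := (u, w)) hψ hS hG l hN ((hT.generator u w).1 huw)
  have hdom : (G.delta y, -v) ∈ generatorGraph T :=
    (hT.generator (G.delta y) v).2 (subset_closure hv)
  have hgrow : ‖N (T t (G.delta y))‖ ≤ Real.exp (c * t) * ‖N (G.delta y)‖ :=
    hT.isC0Semigroup.norm_apply_le_of_weighted_form_ge N hform hdom ht
  have hNy : N (G.delta y) = (Real.exp (l * ψ y) : ℂ) • G.delta y := by
    classical
    refine G.ext_L2 fun z => ?_
    rw [hN, G.ae_vertexMeasure (Lp.coeFn_smul _ (G.delta y)) z, Pi.smul_apply, smul_eq_mul,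
      delta_apply, Pi.single_apply]
    split_ifs with h
    · rw [h]
    · simp
  have hNyn : ‖N (G.delta y)‖ = Real.exp (l * ψ y) * √(G.m y) := by
    rw [hNy, norm_smul, Complex.norm_real, Real.norm_of_nonneg (Real.exp_pos _).le,
      G.norm_delta]
  have hx : Real.exp (l * ψ x) * (inner ℂ (G.delta x) (T t (G.delta y))).re ≤
      √(G.m x) * ‖N (T t (G.delta y))‖ := by
    have h1 : inner ℂ (G.delta x) (N (T t (G.delta y))) =
        (Real.exp (l * ψ x) : ℂ) * inner ℂ (G.delta x) (T t (G.delta y)) := by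
      rw [G.inner_delta_left, G.inner_delta_left, hN]
      ring
    rw [← Complex.re_ofReal_mul, ← h1, ← G.norm_delta]
    exact (Complex.re_le_norm _).trans (norm_inner_le_norm _ _)
  have hmx := G.m_pos x
  have hmy := G.m_pos y
  have hinner : (inner ℂ (G.delta x) (T t (G.delta y))).re ≤
      √(G.m x * G.m y) * Real.exp (c * t - l * (ψ x - ψ y)) := by
    have h1 : Real.exp (c * t - l * (ψ x - ψ y)) =
        Real.exp (c * t) * Real.exp (l * ψ y) / Real.exp (l * ψ x) := by
      rw [← Real.exp_add, ← Real.exp_sub]; ring_nf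
    rw [h1, mul_div_assoc', le_div_iff₀ (Real.exp_pos _), mul_comm _ (Real.exp (l * ψ x)),
      Real.sqrt_mul hmx.le]
    calc _ ≤ √(G.m x) * ‖N (T t (G.delta y))‖ := hx
      _ ≤ √(G.m x) * (Real.exp (c * t) * ‖N (G.delta y)‖) :=
        mul_le_mul_of_nonneg_left hgrow (Real.sqrt_nonneg _)
      _ = _ := by rw [hNyn]; ring
  rw [heatKernel]
  refine (mul_le_mul_of_nonneg_left hinner (by positivity)).trans (le_of_eq ?_)
  rw [← mul_assoc]
  congr 1
  have h2 : √(G.m x * G.m y) * √(G.m x * G.m y) = G.m x * G.m y :=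
    Real.mul_self_sqrt (by positivity)
  rw [one_div_mul_eq_div, div_eq_div_iff (by positivity) (by positivity), one_mul, h2]

theorem daviesMetric_nonneg {X : Type*} (G : WeightedGraph X) (x y : X) : 0 ≤ G.daviesMetric x y :=
  Real.sSup_nonneg fun _ ⟨_, _, hr⟩ => hr ▸ abs_nonneg _

/-- The supremum over the test functions, for a fixed parameter `l`. -/
theorem heatKernel_le_exp_daviesMetric {S : ℝ} (hS : 0 < S) (hG : G.IsRegular S)
    {T : ℝ → G.L2 →L[ℂ] G.L2} (hT : G.IsHeatSemigroup T) (l : ℝ) (x y : X) {t : ℝ}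
    (ht : 0 ≤ t) :
    G.heatKernel T t x y ≤ 1 / √(G.m x * G.m y) *
      Real.exp (2 * (Real.cosh (l * S) - 1) / S ^ 2 * t - l * G.daviesMetric x y) := by
  have hne : {r | ∃ ψ, G.IsTestFunction ψ ∧ r = |ψ x - ψ y|}.Nonempty :=
    ⟨0, 0, ⟨by simp, by simp [energyMeasure]⟩, by simp⟩
  obtain ⟨r, -, hr, hmem⟩ := exists_seq_tendsto_sSup hne (G.bddAbove_daviesMetric x y)
  have hcont : Continuous fun d : ℝ => 1 / √(G.m x * G.m y) *
      Real.exp (2 * (Real.cosh (l * S) - 1) / S ^ 2 * t - l * d) := by fun_prop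
  refine ge_of_tendsto' ((hcont.tendsto _).comp hr) fun n => ?_
  obtain ⟨ψ, hψ, hn⟩ := hmem n
  simp only [Function.comp_apply]
  rw [hn]
  rcases abs_choice (ψ x - ψ y) with h | h
  · rw [h]
    exact heatKernel_le_of_isTestFunction hS hG hT hψ l x y ht
  · rw [h, show -(ψ x - ψ y) = -ψ x - -ψ y by ring]
    exact heatKernel_le_of_isTestFunction hS hG hT (hψ.neg G) l x y ht

end HeatKernel

end WeightedGraph

theorem mainTheorem4 (S : ℝ) (hS : 0 < S) :
    (∀ (X : Type u) [Countable X] [MeasurableSpace X] [DiscreteMeasurableSpace X]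
      (G : WeightedGraph X), G.IsRegular S →
      ∀ T : ℝ → G.L2 →L[ℂ] G.L2, G.IsHeatSemigroup T →
      ∀ (x y : X) (t : ℝ), 0 < t →
        G.heatKernel T t x y ≤ 1 / √(G.m x * G.m y) *
          Real.exp (-(2 * t / S ^ 2 * zeta (G.daviesMetric x y * S / (2 * t))))) ∧
    (∀ ε : ℝ, 0 < ε → ∃ δ : ℝ, 0 < δ ∧
      ∀ (X : Type u) [Countable X] [MeasurableSpace X] [DiscreteMeasurableSpace X]
      (G : WeightedGraph X), G.IsRegular S →
      ∀ T : ℝ → G.L2 →L[ℂ] G.L2, G.IsHeatSemigroup T →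
      ∀ (x y : X) (t : ℝ), 0 < t → G.daviesMetric x y / t < δ →
        G.heatKernel T t x y ≤ 1 / √(G.m x * G.m y) *
          Real.exp (-(G.daviesMetric x y ^ 2 / ((4 + ε) * t)))) := by
  constructor
  · intro X _ _ _ G hG T hT x y t ht
    set r := G.daviesMetric x y * S / (2 * t) with hr
    -- the exponent is minimal for `sinh (l * S) = r`
    have h := WeightedGraph.heatKernel_le_exp_daviesMetric hS hG hT (Real.arsinh r / S) x y ht.le
    refine h.trans_eq ?_
    have hρ : G.daviesMetric x y = 2 * t * r / S := by rw [hr]; field_simp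
    rw [hρ, div_mul_cancel₀ _ hS.ne', Real.cosh_arsinh, zeta, add_comm (r ^ 2)]
    congr 2
    field_simp
    ring
  · intro ε hε
    refine ⟨2 / S * √(2 * ε / (4 + ε)), by positivity, ?_⟩
    intro X _ _ _ G hG T hT x y t ht hδ
    set r := G.daviesMetric x y * S / (2 * t) with hr
    have hρ : G.daviesMetric x y = 2 * t * r / S := by rw [hr]; field_simp
    have hr0 : 0 ≤ r := by
      have := WeightedGraph.daviesMetric_nonneg G x y
      positivity
    have hrs : r < √(2 * ε / (4 + ε)) := by
      rw [hρ] at hδ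
      have e : 2 * t * r / S / t = 2 / S * r := by field_simp
      rw [e] at hδ
      exact lt_of_mul_lt_mul_left hδ (by positivity)
    have hr2 : r ^ 2 ≤ 2 * ε / (4 + ε) := (Real.le_sqrt hr0 (by positivity)).1 hrs.le
    have hr3 : r ^ 2 ≤ 2 := hr2.trans (by rw [div_le_iff₀ (by positivity)]; linarith)
    -- to leading order in `r` the optimal parameter is `r / S`
    have h := WeightedGraph.heatKernel_le_exp_daviesMetric hS hG hT (r / S) x y ht.le
    refine h.trans ?_
    gcongr
    rw [hρ, div_mul_cancel₀ _ hS.ne']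
    have hcosh := Real.cosh_sub_one_le hr3
    have h4 : r ^ 4 / 4 ≤ r ^ 2 / 2 - 2 * r ^ 2 / (4 + ε) := by
      have e : r ^ 2 / 2 - 2 * r ^ 2 / (4 + ε) = r ^ 2 / 4 * (2 * ε / (4 + ε)) := by
        field_simp; ring
      rw [e, show r ^ 4 / 4 = r ^ 2 / 4 * r ^ 2 by ring]
      gcongr
    have e1 : 2 * (Real.cosh r - 1) / S ^ 2 * t - r / S * (2 * t * r / S) =
        2 * t / S ^ 2 * (Real.cosh r - 1 - r ^ 2) := by field_simp
    have e2 : -((2 * t * r / S) ^ 2 / ((4 + ε) * t)) =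
        2 * t / S ^ 2 * -(2 * r ^ 2 / (4 + ε)) := by field_simp
    rw [e1, e2]
    gcongr
    linarith
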